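/- Two risk-neutral players compete for an object. Player $i\in\{1,2\}$ has a private valuation (type) $v_i\ge 0$; the types are independent, and $v_i$ has distribution function $F_i$ with a density and with support $[\underline v_i,\bar v_i]$, where $0\le\underline v_i<\bar v_i$. Player 1 first offers a bribe $b\ge 0$. If player 2 accepts, the payoffs are $v_1-b$ and $b$. If she rejects, the players take part in an all-pay auction: both submit and pay nonnegative bids, the higher bid wins the object, and ties are broken by a fair coin. For types with laws $\tilde F_1,\tilde F_2$, a Bayesian Nash equilibrium (BNE) of this auction is a pair of distributional strategies (probability measures on type-bid pairs with type marginals $\tilde F_i$) under which almost every type-bid pair of each player consists of a type and a bid maximizing that type's expected payoff against the other player's strategy; the auction value of a type is the supremum over nonnegative bids of its expected payoff against the other player's strategy. An equilibrium is a perfect Bayesian equilibrium in which bribes and acceptance decisions are pure. It consists of a bribing function and, for every bribe $b\ge0$, a set of rejecting types of player 2, a belief $\tilde F_1$ on $[\underline v_1,\bar v_1]$ about player 1, a belief $\tilde F_2$ on $[\underline v_2,\bar v_2]$ about player 2 after rejection, and a BNE of the all-pay auction with type laws $\tilde F_1,\tilde F_2$. For bribes on the path, $\tilde F_1$ is the conditional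 law of $v_1$ given the bribe and is concentrated on the types offering it; if the rejecting set has positive probability, $\tilde F_2$ is $F_2$ conditioned on that set; otherwise beliefs are arbitrary. For every $b$, rejecting types of player 2 have auction value at least $b$ and accepting types at most $b$; and no type of player 1 gains by offering another bribe, where his payoff is $v_1-b$ if $b$ is accepted and his auction value if it is rejected. An equilibrium is peaceful if the bribe is accepted with probability one, and peace is implementable if a peaceful equilibrium exists. Let $F_1^{-1}(s)=\inf\{t\in[\underline v_1,\bar v_1]:F_1(t)\ge s\}$, and let $\int_0^1 (F_1^{-1}(s))^{-1}ds\in(0,\infty]$. (i) If $\bar v_2\int_0^1 (F_1^{-1}(s))^{-1}ds\le 1$, then peace is implementable; in fact there is a peaceful equilibrium in which every type of player 1 offers the bribe $0$ and every type of player 2 accepts it. (ii) If $\bar v_2\int_0^1 (F_1^{-1}(s))^{-1}ds>1$ and $\underline v_1=0$, then peace is not implementable. -/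

import Mathlib

open MeasureTheory ProbabilityTheory Set
open scoped NNReal ENNReal

noncomputable section

namespace Bribing

/-- The law `μ` of a nonnegative valuation is an admissible prior: it has a density and its support
is the nondegenerate interval `[lo, hi]`. -/
structure IsPrior (μ : Measure ℝ) (lo hi : ℝ) : Prop where
  nonneg : 0 ≤ lo
  lt : lo < hi
  density : μ ≪ volume
  support_eq : μ.support = Icc lo hi

/-- The quantile function `F⁻¹(s) = inf {t ∈ supp F : F(t) ≥ s}`. -/
def quantile (μ : Measure ℝ) (s : ℝ) : ℝ :=
  sInf {t : ℝ | t ∈ μ.support ∧ s ≤ cdf μ t}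

/-- `∫₀¹ (F⁻¹(s))⁻¹ ds`, as an element of `[0, ∞]`. -/
def invQuantileIntegral (μ : Measure ℝ) : ℝ≥0∞ :=
  ∫⁻ s in Ioo (0 : ℝ) 1, (ENNReal.ofReal (quantile μ s))⁻¹

/-! ### All-pay auctions

A distributional strategy is a probability measure on pairs `(type, bid)`. -/

/-- Probability that a bid `β` wins against an opponent playing the distributional strategy `τ`;
ties are broken by a fair coin. -/
def winProb (τ : Measure (ℝ × ℝ)) (β : ℝ) : ℝ :=
  τ.real {p | p.2 < β} + τ.real {p | p.2 = β} / 2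

/-- Expected payoff of type `v` from bidding `β` against `τ`: the bid is paid in any case. -/
def bidPayoff (τ : Measure (ℝ × ℝ)) (v β : ℝ) : ℝ :=
  v * winProb τ β - β

/-- The supremum expected payoff of type `v` in the auction against `τ`. The supremum is over
a set bounded above by `|v|`. -/
def auctionValue (τ : Measure (ℝ × ℝ)) (v : ℝ) : ℝ :=
  ⨆ β : ℝ≥0, bidPayoff τ v (β : ℝ)

/-- `σ` is a distributional strategy for a player with type distribution `F`, and it is
a best response to `τ`: almost every type-bid pair consists of a type and an optimal bid for it. -/
structure IsBestResponse (F : Measure ℝ) (σ τ : Measure (ℝ × ℝ)) : Prop where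
  isProb : IsProbabilityMeasure σ
  marginal : σ.map Prod.fst = F
  bid_nonneg : ∀ᵐ p ∂σ, 0 ≤ p.2
  optimal : ∀ᵐ p ∂σ, ∀ β : ℝ, 0 ≤ β → bidPayoff τ p.1 β ≤ bidPayoff τ p.1 p.2

/-- Bayesian Nash equilibrium of the all-pay auction with independent types of laws `F₁`, `F₂`. -/
def IsBNE (F₁ F₂ : Measure ℝ) (σ₁ σ₂ : Measure (ℝ × ℝ)) : Prop :=
  IsBestResponse F₁ σ₁ σ₂ ∧ IsBestResponse F₂ σ₂ σ₁

/-! ### The bribing game -/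

/-- Strategies and beliefs in the bribing game. Everything after the offer depends on the
bribe `b` that was offered. -/
structure Assessment where
  /-- the bribe offered by each type of player 1 -/
  bribe : ℝ → ℝ
  /-- the types of player 2 that reject the bribe `b` -/
  reject : ℝ → Set ℝ
  /-- belief about player 1's type after the bribe `b` -/
  belief₁ : ℝ → Measure ℝ
  /-- belief about player 2's type after she rejected the bribe `b` -/
  belief₂ : ℝ → Measure ℝ
  /-- player 1's strategy in the auction after the bribe `b` is rejected -/
  bid₁ : ℝ → Measure (ℝ × ℝ)
  /-- player 2's strategy in the auction after the bribe `b` is rejected -/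
  bid₂ : ℝ → Measure (ℝ × ℝ)

/-- Expected payoff of type `v₁` of player 1 from offering `b`: he gets `v₁ - b` if `b` is
accepted, and his value in the continuation auction if it is rejected. -/
def Assessment.payoff₁ (A : Assessment) (μ₂ : Measure ℝ) (v₁ b : ℝ) : ℝ :=
  (1 - μ₂.real (A.reject b)) * (v₁ - b) + μ₂.real (A.reject b) * auctionValue (A.bid₂ b) v₁

/-- Perfect Bayesian equilibrium of the bribing game in which the types of the players are
independent with laws `μ₁` on `[lo₁, hi₁]` and `μ₂` on `[lo₂, hi₂]`. -/
structure Assessment.IsEquilibrium (A : Assessment) (μ₁ μ₂ : Measure ℝ) [IsFiniteMeasure μ₁]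
    (lo₁ hi₁ lo₂ hi₂ : ℝ) : Prop where
  bribe_measurable : Measurable A.bribe
  bribe_nonneg : ∀ v₁ ∈ Icc lo₁ hi₁, 0 ≤ A.bribe v₁
  reject_measurable : ∀ b, 0 ≤ b → MeasurableSet (A.reject b)
  /-- Beliefs about player 1 are probability laws on his type space. -/
  belief₁_prob : ∀ b, 0 ≤ b →
    IsProbabilityMeasure (A.belief₁ b) ∧ A.belief₁ b (Icc lo₁ hi₁) = 1
  /-- Bayes' rule for on-path bribes: the belief is the conditional law of player 1's type given
  the bribe, and it is concentrated on the types that offer this bribe. -/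
  belief₁_bayes : ∀ᵐ b ∂(μ₁.map A.bribe), A.belief₁ b = condDistrib id A.bribe μ₁ b
  belief₁_sender : ∀ v₁ ∈ Icc lo₁ hi₁,
    A.belief₁ (A.bribe v₁) {w | w ∈ Icc lo₁ hi₁ ∧ A.bribe w = A.bribe v₁} = 1
  /-- Beliefs about player 2 are probability laws on her type space. -/
  belief₂_prob : ∀ b, 0 ≤ b →
    IsProbabilityMeasure (A.belief₂ b) ∧ A.belief₂ b (Icc lo₂ hi₂) = 1
  /-- Bayes' rule after a rejection that has positive probability. -/
  belief₂_bayes : ∀ b, 0 ≤ b → μ₂ (A.reject b) ≠ 0 → A.belief₂ b = μ₂[|A.reject b]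
  /-- After the rejection of any bribe an equilibrium of the continuation auction is played. -/
  auction : ∀ b, 0 ≤ b → IsBNE (A.belief₁ b) (A.belief₂ b) (A.bid₁ b) (A.bid₂ b)
  /-- A type of player 2 that rejects `b` gets at least `b` in the continuation auction. -/
  reject_optimal : ∀ b, 0 ≤ b → ∀ v₂ ∈ Icc lo₂ hi₂, v₂ ∈ A.reject b →
    b ≤ auctionValue (A.bid₁ b) v₂
  /-- A type of player 2 that accepts `b` gets at most `b` in the continuation auction. -/
  accept_optimal : ∀ b, 0 ≤ b → ∀ v₂ ∈ Icc lo₂ hi₂, v₂ ∉ A.reject b →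
    auctionValue (A.bid₁ b) v₂ ≤ b
  /-- No type of player 1 gains by offering another bribe. -/
  bribe_optimal : ∀ v₁ ∈ Icc lo₁ hi₁, ∀ b, 0 ≤ b →
    A.payoff₁ μ₂ v₁ b ≤ A.payoff₁ μ₂ v₁ (A.bribe v₁)

/-- Peace occurs with probability one: almost every type of player 1 offers a bribe that almost
every type of player 2 accepts. -/
def Assessment.IsPeaceful (A : Assessment) (μ₁ μ₂ : Measure ℝ) : Prop :=
  ∀ᵐ v₁ ∂μ₁, μ₂ (A.reject (A.bribe v₁)) = 0

/-- Peace is implementable: there is a peaceful equilibrium. -/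
def PeaceImplementable (μ₁ μ₂ : Measure ℝ) [IsFiniteMeasure μ₁] (lo₁ hi₁ lo₂ hi₂ : ℝ) : Prop :=
  ∃ A : Assessment, A.IsEquilibrium μ₁ μ₂ lo₁ hi₁ lo₂ hi₂ ∧ A.IsPeaceful μ₁ μ₂

end Bribing

end

namespace Bribing

/-! ### Winning probabilities and auction values -/

section Auction

variable (τ : Measure (ℝ × ℝ)) [IsProbabilityMeasure τ]

/-! Necessity. Since player 1's types reach down to `0`, and offering `0` never yields a negative
payoff, accepted bribes are at most the sender's type. Mimicking types near `0` then forces almost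
every bribe to be `0`. The belief after `0` is the prior, and acceptance by types near `v = hi₂`
means that a rival of valuation `v` earns no rent: a bid `β` wins with probability at most `β / v`.
Player 1's value per unit of valuation, as a function `g` of `y = 1 / t`, lies in `[0, 1]`, and
minus its slope is the optimal bid. Types below `1 / y` therefore bid at most about `-g'(y)`, and
zero rent gives `v F(1 / y) ≤ -g'(y)` (`mul_cdf_mul_le`). Integrating, `v ∫ F(1 / y) dy ≤ g(0) ≤ 1`,
and the layer-cake formula turns the left side into `v ∫ 1 / F⁻¹`. The proof uses finite differences
and Riemann sums, so no derivative of `g` is needed. Sufficiency. All bribes are accepted, and a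
rejection is attributed to type `v`. In that auction type `t` bids `v F(t)`, which is uniform on
`[0, v]` and leaves the rival no rent; the rival's density `1 / F⁻¹(x / v)` makes these bids
optimal, and the remaining mass, nonnegative by hypothesis, sits at `0`. -/

lemma winProb_nonneg (τ : Measure (ℝ × ℝ)) (β : ℝ) : 0 ≤ winProb τ β := by
  unfold winProb; positivity

lemma real_lt_le_winProb (τ : Measure (ℝ × ℝ)) (β : ℝ) : τ.real {p | p.2 < β} ≤ winProb τ β := by
  unfold winProb
  have : 0 ≤ τ.real {p : ℝ × ℝ | p.2 = β} := measureReal_nonneg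
  linarith

lemma winProb_le_real_le (β : ℝ) : winProb τ β ≤ τ.real {p | p.2 ≤ β} := by
  have hs : MeasurableSet {p : ℝ × ℝ | p.2 = β} := measurable_snd (measurableSet_singleton β)
  have hd : Disjoint {p : ℝ × ℝ | p.2 < β} {p | p.2 = β} :=
    Set.disjoint_left.2 fun p hp hq => hp.ne hq
  have hu : {p : ℝ × ℝ | p.2 ≤ β} = {p | p.2 < β} ∪ {p | p.2 = β} := by
    ext p; simp [le_iff_lt_or_eq]
  have h0 : 0 ≤ τ.real {p : ℝ × ℝ | p.2 = β} := measureReal_nonneg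
  rw [hu, measureReal_union hd hs, winProb]
  linarith

lemma winProb_le_one (β : ℝ) : winProb τ β ≤ 1 :=
  (winProb_le_real_le τ β).trans measureReal_le_one

lemma bidPayoff_le {v β : ℝ} (hv : 0 ≤ v) (hβ : 0 ≤ β) : bidPayoff τ v β ≤ v := by
  have := mul_le_mul_of_nonneg_left (winProb_le_one τ β) hv
  unfold bidPayoff
  linarith

lemma bidPayoff_le_auctionValue {v β : ℝ} (hv : 0 ≤ v) (hβ : 0 ≤ β) :
    bidPayoff τ v β ≤ auctionValue τ v :=
  le_ciSup (f := fun β : ℝ≥0 => bidPayoff τ v β)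
    ⟨v, by rintro _ ⟨x, rfl⟩; exact bidPayoff_le τ hv x.2⟩ ⟨β, hβ⟩

lemma auctionValue_nonneg {v : ℝ} (hv : 0 ≤ v) : 0 ≤ auctionValue τ v := by
  refine le_trans ?_ (bidPayoff_le_auctionValue τ hv le_rfl)
  simpa [bidPayoff] using mul_nonneg hv (winProb_nonneg τ 0)

end Auction

/-! ### Priors -/

section Prior

variable {μ : Measure ℝ} {lo hi : ℝ}

lemma IsPrior.ae_mem_Icc (h : IsPrior μ lo hi) : ∀ᵐ t ∂μ, t ∈ Icc lo hi := by
  have := Measure.support_mem_ae (μ := μ)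
  rwa [h.support_eq] at this

lemma IsPrior.nullSingletonClass (h : IsPrior μ lo hi) : NullSingletonClass μ :=
  ⟨fun x => h.density (measure_singleton x)⟩

lemma IsPrior.ae_mem_Ioc (h : IsPrior μ lo hi) : ∀ᵐ t ∂μ, t ∈ Ioc lo hi := by
  have := h.nullSingletonClass
  filter_upwards [h.ae_mem_Icc, compl_mem_ae_iff.2 (measure_singleton (μ := μ) lo)] with t ht hne
  exact ⟨lt_of_le_of_ne ht.1 (Ne.symm hne), ht.2⟩

/-- The endpoint is in the support, so its neighbourhoods have positive mass. This turns almost-sure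
statements into witnesses arbitrarily close to the extreme type. -/
lemma IsPrior.exists_lt (h : IsPrior μ lo hi) {x : ℝ} (hx : lo < x) {p : ℝ → Prop}
    (hp : ∀ᵐ t ∂μ, p t) : ∃ t < x, p t := by
  have hpos : 0 < μ (Iio x) := (Measure.mem_support_iff_forall lo).1
    (h.support_eq ▸ left_mem_Icc.2 h.lt.le) _ (Iio_mem_nhds hx)
  obtain ⟨t, ht, hpt⟩ := ((frequently_ae_mem_iff.2 hpos.ne').and_eventually hp).exists
  exact ⟨t, ht, hpt⟩

lemma IsPrior.exists_gt (h : IsPrior μ lo hi) {x : ℝ} (hx : x < hi) {p : ℝ → Prop}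
    (hp : ∀ᵐ t ∂μ, p t) : ∃ t > x, p t := by
  have hpos : 0 < μ (Ioi x) := (Measure.mem_support_iff_forall hi).1
    (h.support_eq ▸ right_mem_Icc.2 h.lt.le) _ (Ioi_mem_nhds hx)
  obtain ⟨t, ht, hpt⟩ := ((frequently_ae_mem_iff.2 hpos.ne').and_eventually hp).exists
  exact ⟨t, ht, hpt⟩

lemma IsPrior.bddBelow (h : IsPrior μ lo hi) (s : ℝ) :
    BddBelow {t : ℝ | t ∈ μ.support ∧ s ≤ cdf μ t} :=
  ⟨lo, fun t ht => by have := ht.1; rw [h.support_eq] at this; exact this.1⟩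

lemma IsPrior.quantile_le (h : IsPrior μ lo hi) {s t : ℝ} (ht : t ∈ Icc lo hi)
    (hs : s ≤ cdf μ t) : quantile μ s ≤ t :=
  csInf_le (h.bddBelow s) ⟨h.support_eq.symm ▸ ht, hs⟩

variable [IsProbabilityMeasure μ]

lemma IsPrior.cdf_hi (h : IsPrior μ lo hi) : cdf μ hi = 1 := by
  have : ∀ᵐ t ∂μ, t ∈ Iic hi := h.ae_mem_Icc.mono fun t ht => ht.2
  rw [cdf_eq_real, measureReal_def, (mem_ae_iff_prob_eq_one measurableSet_Iic).1 this,
    ENNReal.toReal_one]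

lemma IsPrior.nonempty (h : IsPrior μ lo hi) {s : ℝ} (hs : s ≤ 1) :
    {t : ℝ | t ∈ μ.support ∧ s ≤ cdf μ t}.Nonempty :=
  ⟨hi, h.support_eq ▸ right_mem_Icc.2 h.lt.le, h.cdf_hi.symm ▸ hs⟩

/-- Right continuity of the distribution function. With `IsPrior.quantile_le` it makes quantile and
distribution function a Galois pair on the support interval. -/
lemma IsPrior.le_cdf_of_quantile_le (h : IsPrior μ lo hi) {s t : ℝ} (hs : s ≤ 1)
    (hq : quantile μ s ≤ t) : s ≤ cdf μ t := by
  have hc := ((cdf μ).right_continuous t).tendsto.mono_left (nhdsWithin_mono t Ioi_subset_Ici_self)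
  refine ge_of_tendsto hc ?_
  filter_upwards [self_mem_nhdsWithin] with x hx
  obtain ⟨y, hy, hyx⟩ := exists_lt_of_csInf_lt (h.nonempty hs) (lt_of_le_of_lt hq hx)
  exact hy.2.trans (monotone_cdf μ hyx.le)

lemma IsPrior.le_quantile (h : IsPrior μ lo hi) {s t : ℝ} (hs : s ≤ 1) (ht : cdf μ t < s) :
    t ≤ quantile μ s := by
  by_contra! hlt
  exact absurd (h.le_cdf_of_quantile_le hs hlt.le) ht.not_ge

lemma IsPrior.cdf_lo (h : IsPrior μ lo hi) : cdf μ lo = 0 := by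
  rw [cdf_eq_real, measureReal_def, measure_mono_null _ (ae_iff.1 h.ae_mem_Ioc)]
  · simp
  · exact fun t ht hm => absurd hm.1 (not_lt.2 ht)

/-- Positivity is what lets the real inverse and the `ℝ≥0∞` inverse of the quantile be exchanged;
they disagree at `0`. -/
lemma IsPrior.quantile_pos (h : IsPrior μ lo hi) {s : ℝ} (h0 : 0 < s) (h1 : s ≤ 1) :
    0 < quantile μ s := by
  refine lt_of_le_of_lt h.nonneg (lt_of_not_ge fun hle => ?_)
  have := h.le_cdf_of_quantile_le h1 hle
  rw [h.cdf_lo] at this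
  linarith

lemma IsPrior.monotoneOn_quantile (h : IsPrior μ lo hi) : MonotoneOn (quantile μ) (Ioo 0 1) :=
  fun s _ _ ht hst => csInf_le_csInf (h.bddBelow s) (h.nonempty ht.2.le)
    fun _ hx => ⟨hx.1, hst.trans hx.2⟩

lemma IsPrior.aemeasurable_quantile (h : IsPrior μ lo hi) :
    AEMeasurable (quantile μ) (volume.restrict (Ioo 0 1)) :=
  aemeasurable_restrict_of_monotoneOn measurableSet_Ioo h.monotoneOn_quantile

end Prior

/-- An almost surely constant signal carries no information. Its law is a Dirac mass at `c`, so the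
almost-everywhere identity of kernels holds at the point `c` itself. -/
lemma condDistrib_id_of_ae_eq_const {μ : Measure ℝ} [IsProbabilityMeasure μ] {X : ℝ → ℝ} {c : ℝ}
    (hX : X =ᵐ[μ] fun _ => c) : condDistrib id X μ c = μ := by
  rw [condDistrib_congr_right hX]
  have h : condDistrib id (fun _ : ℝ => c) μ =ᵐ[μ.map fun _ => c] Kernel.const ℝ μ := by
    refine condDistrib_ae_eq_of_measure_eq_compProd _ aemeasurable_id ?_
    simp [Measure.map_const, Measure.compProd_const, Measure.dirac_prod]
  simpa [Measure.map_const, Filter.EventuallyEq, ae_dirac_eq] using h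

/-! ### The necessary condition -/

/-- The auction value per unit of valuation, as a function of the inverse valuation `y`. -/
noncomputable def scaledValue (τ : Measure (ℝ × ℝ)) (y : ℝ) : ℝ :=
  ⨆ β : ℝ≥0, (winProb τ β - β * y)

section ScaledValue

variable (τ : Measure (ℝ × ℝ)) [IsProbabilityMeasure τ]

lemma le_scaledValue {y β : ℝ} (hy : 0 ≤ y) (hβ : 0 ≤ β) :
    winProb τ β - β * y ≤ scaledValue τ y := by
  refine le_ciSup (f := fun β : ℝ≥0 => winProb τ β - β * y) ⟨1, ?_⟩ ⟨β, hβ⟩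
  rintro _ ⟨x, rfl⟩
  have := winProb_le_one τ x
  have := mul_nonneg x.coe_nonneg hy
  dsimp only
  linarith

lemma scaledValue_le_one {y : ℝ} (hy : 0 ≤ y) : scaledValue τ y ≤ 1 :=
  ciSup_le fun x => by
    have := winProb_le_one τ x
    have := mul_nonneg x.coe_nonneg hy
    linarith

lemma scaledValue_nonneg {y : ℝ} (hy : 0 ≤ y) : 0 ≤ scaledValue τ y := by
  have := le_scaledValue τ hy le_rfl
  have := winProb_nonneg τ 0
  linarith

/-- The slope of the scaled value to the left of `y'` dominates every bid that is optimal for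
a type below `1 / y'`. -/
lemma scaledValue_add_le {y y' t x : ℝ} (hy : 0 ≤ y) (hyy : y ≤ y') (ht : 0 < t)
    (hty : y' ≤ t⁻¹) (hx : 0 ≤ x)
    (hopt : ∀ β : ℝ, 0 ≤ β → bidPayoff τ t β ≤ bidPayoff τ t x) :
    scaledValue τ y' + x * (y' - y) ≤ scaledValue τ y := by
  rw [← le_sub_iff_add_le]
  refine ciSup_le fun β => ?_
  have hβ : (0 : ℝ) ≤ β := β.2
  -- A bid `β ≥ x` is itself tried at `y`, where it costs less by `β * (y' - y)`; for a smaller `β`,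
  -- the optimal `x` is tried instead.
  rcases le_total x β with hxb | hbx
  · have h1 := le_scaledValue τ hy hβ
    have h2 := mul_le_mul_of_nonneg_right hxb (sub_nonneg.2 hyy)
    linarith
  · have h1 := le_scaledValue τ hy hx
    have h2 : (x - β) * t⁻¹ ≤ winProb τ x - winProb τ β := by
      have := hopt β hβ
      unfold bidPayoff at this
      rw [← div_eq_mul_inv, div_le_iff₀ ht]
      linarith
    have h3 := mul_le_mul_of_nonneg_left hty (sub_nonneg.2 hbx)
    linarith

end ScaledValue

/-- A bid equal to `c` wins ties only half the time; overbidding `c` slightly beats every bid up to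
`c`, and the excess tends to `0`. -/
lemma real_le_le_of_forall_winProb_le {τ : Measure (ℝ × ℝ)} [IsProbabilityMeasure τ] {v : ℝ}
    (hwin : ∀ β : ℝ, 0 ≤ β → v * winProb τ β ≤ β) (hv : 0 ≤ v) {c : ℝ} (hc : 0 ≤ c) :
    v * τ.real {p | p.2 ≤ c} ≤ c := by
  refine le_of_forall_gt_imp_ge_of_dense fun a ha => ?_
  refine le_trans (mul_le_mul_of_nonneg_left ?_ hv) (hwin a (hc.trans ha.le))
  exact (measureReal_mono fun p hp => lt_of_le_of_lt hp ha).trans (real_lt_le_winProb τ a)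

section Necessity

variable {μ : Measure ℝ} [IsProbabilityMeasure μ] {lo hi : ℝ} {σ τ : Measure (ℝ × ℝ)}
  [IsProbabilityMeasure τ] {v : ℝ}

/-- Every type up to `1 / y'` bids at most the secant slope `c` of the scaled value over `[y, y']`,
so bids up to `c` have mass at least `F(1 / y')`. Zero rent caps that mass at `c / v`. -/
lemma mul_cdf_mul_le (h : IsPrior μ lo hi) (hσ : IsBestResponse μ σ τ) (hv : 0 ≤ v)
    (hwin : ∀ β : ℝ, 0 ≤ β → v * winProb σ β ≤ β) {y y' : ℝ} (hy : 0 ≤ y) (hyy : y < y') :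
    v * cdf μ y'⁻¹ * (y' - y) ≤ scaledValue τ y - scaledValue τ y' := by
  have := hσ.isProb
  have hd : 0 < y' - y := sub_pos.2 hyy
  have hy' : 0 < y' := hy.trans_lt hyy
  set c := (scaledValue τ y - scaledValue τ y') / (y' - y) with hc
  rw [← le_div_iff₀ hd, ← hc]
  have hpos : ∀ᵐ p ∂σ, p.1 ∈ Ioc lo hi := by
    refine ae_of_ae_map measurable_fst.aemeasurable ?_
    rw [hσ.marginal]
    exact h.ae_mem_Ioc
  have hbid : ∀ᵐ p ∂σ, p.1 ≤ y'⁻¹ → p.2 ≤ c := by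
    filter_upwards [hpos, hσ.bid_nonneg, hσ.optimal] with p hp hp0 hopt hle
    have ht : 0 < p.1 := h.nonneg.trans_lt hp.1
    have := scaledValue_add_le τ hy hyy.le ht ((le_inv_comm₀ ht hy').1 hle) hp0 hopt
    rw [hc, le_div_iff₀ hd]
    linarith
  have hc0 : 0 ≤ c := by
    refine div_nonneg (sub_nonneg.2 (ciSup_le fun β => ?_)) hd.le
    have := le_scaledValue τ hy β.coe_nonneg
    have := mul_le_mul_of_nonneg_left hyy.le β.coe_nonneg
    linarith
  refine le_trans (mul_le_mul_of_nonneg_left ?_ hv) (real_le_le_of_forall_winProb_le hwin hv hc0)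
  rw [cdf_eq_real, ← hσ.marginal, map_measureReal_apply measurable_fst measurableSet_Iic]
  exact ENNReal.toReal_mono (measure_ne_top _ _) (measure_mono_ae hbid)

lemma mul_sum_cdf_le (h : IsPrior μ lo hi) (hσ : IsBestResponse μ σ τ) (hv : 0 ≤ v)
    (hwin : ∀ β : ℝ, 0 ≤ β → v * winProb σ β ≤ β) {δ : ℝ} (hδ : 0 < δ) (n : ℕ) :
    v * ∑ i ∈ Finset.range n, δ * cdf μ (((i + 1 : ℕ) : ℝ) * δ)⁻¹ ≤ 1 := by
  have key : v * ∑ i ∈ Finset.range n, δ * cdf μ (((i + 1 : ℕ) : ℝ) * δ)⁻¹ ≤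
      ∑ i ∈ Finset.range n,
        (scaledValue τ ((i : ℕ) * δ) - scaledValue τ (((i + 1 : ℕ) : ℝ) * δ)) := by
    rw [Finset.mul_sum]
    refine Finset.sum_le_sum fun i _ => ?_
    have := mul_cdf_mul_le h hσ hv hwin (y := i * δ) (y' := ((i + 1 : ℕ) : ℝ) * δ)
      (by positivity) (by push_cast; linarith)
    refine le_trans (le_of_eq ?_) this
    push_cast
    ring
  rw [Finset.sum_range_sub' (fun i : ℕ => scaledValue τ (i * δ))] at key
  rw [Nat.cast_zero, zero_mul] at key
  have h1 := scaledValue_le_one τ le_rfl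
  have h2 := scaledValue_nonneg τ (y := (n : ℝ) * δ) (by positivity)
  linarith

end Necessity

/-! ### From Riemann sums of `F(1 / y)` to the integral of the inverse quantile -/

lemma volume_quantile_le {μ : Measure ℝ} [IsProbabilityMeasure μ] {lo hi : ℝ}
    (h : IsPrior μ lo hi) (t : ℝ) :
    volume.restrict (Ioo 0 1) {s | quantile μ s ≤ t} ≤ ENNReal.ofReal (cdf μ t) := by
  have hsub : {s | quantile μ s ≤ t} ∩ Ioo 0 1 ⊆ Ioc 0 (cdf μ t) := fun s hs =>
    ⟨hs.2.1, h.le_cdf_of_quantile_le hs.2.2.le hs.1⟩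
  rw [Measure.restrict_apply' measurableSet_Ioo]
  exact (measure_mono hsub).trans (by simp)

/-- The sum is `f` rounded down to the grid of mesh `δ`, truncated at `n * δ`; rounding loses at
most `δ`. This is the discrete layer-cake formula. -/
lemma min_le_add_card_mul {f δ : ℝ} (hf : 0 ≤ f) (hδ : 0 < δ) (n : ℕ) :
    min (n * δ) f ≤ δ + ∑ i ∈ Finset.range n, if ((i + 1 : ℕ) : ℝ) * δ ≤ f then δ else 0 := by
  induction n with
  | zero => simp [hf]; exact hδ.le
  | succ n ih =>
    rw [Finset.sum_range_succ]
    split_ifs with hle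
    · have hn : (n : ℝ) * δ ≤ f := by push_cast at hle; linarith
      rw [min_eq_left hn] at ih
      rw [min_eq_left hle, Nat.cast_succ]
      linarith
    · by_cases hn : (n : ℝ) * δ ≤ f
      · have hsum : ∑ i ∈ Finset.range n, (if ((i + 1 : ℕ) : ℝ) * δ ≤ f then δ else 0) = n * δ := by
          rw [Finset.sum_congr rfl (g := fun _ => δ)]
          · simp
          · intro i hi
            refine if_pos (le_trans (mul_le_mul_of_nonneg_right ?_ hδ.le) hn)
            exact_mod_cast Finset.mem_range.1 hi
        rw [hsum]
        push_cast
        refine (min_le_left _ _).trans (by linarith)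
      · push Not at hn
        rw [min_eq_right hn.le] at ih
        exact (min_le_right _ _).trans (by linarith)

/-- If a best response of player 1 yields no rent to a rival of valuation `v`, then
`v ∫₀¹ (F⁻¹(s))⁻¹ ds ≤ 1`. -/
theorem mul_invQuantileIntegral_le_one {μ : Measure ℝ} [IsProbabilityMeasure μ] {lo hi : ℝ}
    {σ τ : Measure (ℝ × ℝ)} [IsProbabilityMeasure τ] {v : ℝ}
    (h : IsPrior μ lo hi) (hσ : IsBestResponse μ σ τ) (hv : 0 < v)
    (hwin : ∀ β : ℝ, 0 ≤ β → v * winProb σ β ≤ β) :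
    ENNReal.ofReal v * invQuantileIntegral μ ≤ 1 := by
  set ν := volume.restrict (Ioo (0 : ℝ) 1) with hν
  set f : ℝ → ℝ := fun s => (quantile μ s)⁻¹ with hf
  have hfm : AEMeasurable f ν := h.aemeasurable_quantile.inv
  have hbound : ∀ n : ℕ, ∫⁻ s, ENNReal.ofReal (min (n + 1 : ℕ) (f s)) ∂ν ≤
      ENNReal.ofReal (1 / ((n : ℝ) + 1) + 1 / v) := by
    intro n
    set δ : ℝ := 1 / ((n : ℝ) + 1) with hδ
    have hδ0 : 0 < δ := by positivity
    -- With mesh `1 / (n + 1)`, this many cells reach the truncation level `n + 1`, so the mesh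
    -- shrinks while the range grows.
    set m : ℕ := (n + 1) ^ 2 with hm
    have hmδ : (m : ℝ) * δ = (n + 1 : ℕ) := by rw [hm, hδ]; push_cast; field_simp
    calc ∫⁻ s, ENNReal.ofReal (min (n + 1 : ℕ) (f s)) ∂ν
        ≤ ∫⁻ s, (ENNReal.ofReal δ + ∑ i ∈ Finset.range m,
            {s | quantile μ s ≤ (((i + 1 : ℕ) : ℝ) * δ)⁻¹}.indicator
              (fun _ => ENNReal.ofReal δ) s) ∂ν := by
          refine lintegral_mono_ae ?_
          filter_upwards [ae_restrict_mem measurableSet_Ioo] with s hs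
          have hq : 0 < quantile μ s := h.quantile_pos hs.1 hs.2.le
          have := min_le_add_card_mul (inv_pos.2 hq).le hδ0 m
          rw [hmδ] at this
          refine (ENNReal.ofReal_le_ofReal this).trans ?_
          refine ENNReal.ofReal_add_le.trans ?_
          gcongr
          rw [ENNReal.ofReal_sum_of_nonneg (fun i _ => by split_ifs <;> positivity)]
          refine Finset.sum_le_sum fun i _ => ?_
          have hi : 0 < ((i + 1 : ℕ) : ℝ) * δ := by positivity
          split_ifs with hle
          · have hmem : s ∈ {s | quantile μ s ≤ (((i + 1 : ℕ) : ℝ) * δ)⁻¹} :=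
              (le_inv_comm₀ hi hq).1 hle
            rw [indicator_of_mem hmem]
          · simp
      _ ≤ ENNReal.ofReal δ + ∑ i ∈ Finset.range m,
            ENNReal.ofReal δ * ENNReal.ofReal (cdf μ (((i + 1 : ℕ) : ℝ) * δ)⁻¹) := by
          rw [lintegral_add_left measurable_const, lintegral_finsetSum']
          · have hν1 : ν univ = 1 := by simp [hν]
            rw [lintegral_const, hν1, mul_one]
            gcongr with i _
            refine (lintegral_indicator_const_le _ _).trans ?_
            gcongr
            exact volume_quantile_le h _
          · intro i _
            refine aemeasurable_const.indicator₀ ?_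
            exact nullMeasurableSet_le h.aemeasurable_quantile aemeasurable_const
      _ = ENNReal.ofReal (δ + ∑ i ∈ Finset.range m, δ * cdf μ (((i + 1 : ℕ) : ℝ) * δ)⁻¹) := by
          rw [ENNReal.ofReal_add hδ0.le
            (Finset.sum_nonneg fun i _ => mul_nonneg hδ0.le (cdf_nonneg _ _)),
            ENNReal.ofReal_sum_of_nonneg fun i _ => mul_nonneg hδ0.le (cdf_nonneg _ _)]
          simp_rw [ENNReal.ofReal_mul hδ0.le]
      _ ≤ ENNReal.ofReal (δ + 1 / v) := by
          gcongr
          rw [le_div_iff₀ hv, mul_comm]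
          exact mul_sum_cdf_le h hσ hv.le hwin hδ0 m
  have hint : invQuantileIntegral μ ≤ ENNReal.ofReal (1 / v) := by
    calc invQuantileIntegral μ
        = ∫⁻ s, Filter.liminf (fun n : ℕ => ENNReal.ofReal (min (n + 1 : ℕ) (f s)))
            Filter.atTop ∂ν := by
          refine setLIntegral_congr_fun measurableSet_Ioo fun s hs => ?_
          have hq : 0 < quantile μ s := h.quantile_pos hs.1 hs.2.le
          obtain ⟨N, hN⟩ := exists_nat_ge (f s)
          have ht : Filter.Tendsto (fun n : ℕ => ENNReal.ofReal (min (n + 1 : ℕ) (f s)))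
              Filter.atTop (nhds (ENNReal.ofReal (f s))) := by
            refine tendsto_const_nhds.congr' ?_
            filter_upwards [Filter.eventually_ge_atTop N] with n hn
            rw [min_eq_right]
            refine hN.trans ?_
            exact_mod_cast hn.trans (Nat.le_succ n)
          rw [ht.liminf_eq, ENNReal.ofReal_inv_of_pos hq]
      -- Fatou's lemma removes the truncation, without assuming that the integral is finite.
      _ ≤ Filter.liminf (fun n : ℕ => ∫⁻ s, ENNReal.ofReal (min (n + 1 : ℕ) (f s)) ∂ν)
            Filter.atTop :=
          lintegral_liminf_le' fun n => (aemeasurable_const.min hfm).ennreal_ofReal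
      _ ≤ Filter.liminf (fun n : ℕ => ENNReal.ofReal (1 / ((n : ℝ) + 1) + 1 / v))
            Filter.atTop := Filter.liminf_le_liminf (Filter.Eventually.of_forall hbound)
      _ = ENNReal.ofReal (1 / v) := by
          refine Filter.Tendsto.liminf_eq (ENNReal.tendsto_ofReal ?_)
          simpa using (tendsto_one_div_add_atTop_nhds_zero_nat (𝕜 := ℝ)).add_const (1 / v)
  calc ENNReal.ofReal v * invQuantileIntegral μ
      ≤ ENNReal.ofReal v * ENNReal.ofReal (1 / v) := by gcongr
    _ = 1 := by rw [← ENNReal.ofReal_mul hv.le, mul_one_div_cancel hv.ne', ENNReal.ofReal_one]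

/-- If peace is implementable and player 1's lowest type is `0`, then
`v̄₂ ∫₀¹ (F₁⁻¹(s))⁻¹ ds ≤ 1`. -/
theorem PeaceImplementable.mul_invQuantileIntegral_le_one {μ₁ μ₂ : Measure ℝ}
    [IsProbabilityMeasure μ₁] [IsProbabilityMeasure μ₂] {hi₁ lo₂ hi₂ : ℝ}
    (h₁ : IsPrior μ₁ 0 hi₁) (h₂ : IsPrior μ₂ lo₂ hi₂)
    (hP : PeaceImplementable μ₁ μ₂ 0 hi₁ lo₂ hi₂) :
    ENNReal.ofReal hi₂ * invQuantileIntegral μ₁ ≤ 1 := by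
  obtain ⟨A, hA, hpeace⟩ := hP
  have hS : ∀ᵐ v ∂μ₁, v ∈ Icc 0 hi₁ ∧ μ₂ (A.reject (A.bribe v)) = 0 :=
    h₁.ae_mem_Icc.and hpeace
  have hpay : ∀ v w, μ₂ (A.reject (A.bribe v)) = 0 →
      A.payoff₁ μ₂ w (A.bribe v) = w - A.bribe v := by
    intro v w hv
    simp [Assessment.payoff₁, measureReal_def, hv]
  have hle : ∀ v ∈ Icc 0 hi₁, μ₂ (A.reject (A.bribe v)) = 0 → A.bribe v ≤ v := by
    intro v hv hr
    have := (hA.auction 0 le_rfl).2.isProb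
    have hopt := hA.bribe_optimal v hv 0 le_rfl
    rw [hpay v v hr] at hopt
    have hnonneg : 0 ≤ A.payoff₁ μ₂ v 0 :=
      add_nonneg (mul_nonneg (sub_nonneg.2 measureReal_le_one) (by simpa using hv.1))
        (mul_nonneg measureReal_nonneg (auctionValue_nonneg _ hv.1))
    linarith
  have hzero : ∀ v ∈ Icc 0 hi₁, μ₂ (A.reject (A.bribe v)) = 0 → A.bribe v = 0 := by
    intro v hv hr
    refine le_antisymm (le_of_forall_pos_le_add fun ε hε => ?_) (hA.bribe_nonneg v hv)
    obtain ⟨w, hw, hwS⟩ := h₁.exists_lt hε hS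
    have hopt := hA.bribe_optimal v hv (A.bribe w) (hA.bribe_nonneg w hwS.1)
    rw [hpay v v hr, hpay w v hwS.2] at hopt
    have := hle w hwS.1 hwS.2
    linarith
  have hbribe : A.bribe =ᵐ[μ₁] fun _ => 0 := by
    filter_upwards [hS] with v hv using hzero v hv.1 hv.2
  have hrej : μ₂ (A.reject 0) = 0 := by
    obtain ⟨v, -, hv⟩ := h₁.exists_lt (h₁.lt) hS
    rw [← hzero v hv.1 hv.2]
    exact hv.2
  have hbelief : A.belief₁ 0 = μ₁ := by
    have := hA.belief₁_bayes
    rw [Measure.map_congr hbribe, Measure.map_const] at this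
    simp only [measure_univ, one_smul, ae_dirac_eq] at this
    exact Filter.eventually_pure.1 this |>.trans (condDistrib_id_of_ae_eq_const hbribe)
  obtain ⟨hbr₁, hbr₂⟩ := hA.auction 0 le_rfl
  rw [hbelief] at hbr₁
  have := hbr₁.isProb
  have := hbr₂.isProb
  have hhi : 0 < hi₂ := h₂.nonneg.trans_lt h₂.lt
  refine Bribing.mul_invQuantileIntegral_le_one h₁ hbr₁ hhi fun β hβ => ?_
  have hacc : ∀ᵐ w ∂μ₂, w ∈ Icc lo₂ hi₂ ∧ w ∉ A.reject 0 :=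
    h₂.ae_mem_Icc.and (compl_mem_ae_iff.2 hrej)
  -- Type `hi₂` itself might reject, so the zero-rent bound is taken from accepting types within `ε`
  -- of it.
  refine le_of_forall_pos_le_add fun ε hε => ?_
  obtain ⟨w, hw, hwS⟩ := h₂.exists_gt (sub_lt_self hi₂ hε) hacc
  have hval := hA.accept_optimal 0 le_rfl w hwS.1 hwS.2
  have hbid := bidPayoff_le_auctionValue (A.bid₁ 0) (h₂.nonneg.trans hwS.1.1) hβ
  unfold bidPayoff at hbid
  have h0 := winProb_nonneg (A.bid₁ 0) β
  have h1 := winProb_le_one (A.bid₁ 0) β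
  nlinarith

/-! ### The peaceful equilibrium -/

section CDF

variable {μ : Measure ℝ} [IsProbabilityMeasure μ] [NullSingletonClass μ]

lemma continuous_cdf : Continuous (cdf μ) := by
  refine continuous_iff_continuousAt.2 fun x => ?_
  rw [(monotone_cdf μ).continuousAt_iff_leftLim_eq_rightLim, (cdf μ).rightLim_eq]
  refine le_antisymm ((monotone_cdf μ).leftLim_le le_rfl) ?_
  have := (cdf μ).measure_singleton x
  rw [measure_cdf, measure_singleton, eq_comm, ENNReal.ofReal_eq_zero] at this
  linarith

lemma exists_cdf_eq {u : ℝ} (h0 : 0 < u) (h1 : u < 1) : ∃ t, cdf μ t = u :=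
  mem_range_of_exists_le_of_exists_ge continuous_cdf
    ((tendsto_cdf_atBot μ).eventually_le_const h0).exists
    ((tendsto_cdf_atTop μ).eventually_const_le h1).exists

/-- Half of the probability integral transform, that `F(t)` is uniform for an atomless law;
`le_real_cdf_lt` is the other half. -/
lemma real_cdf_le_le {u : ℝ} (hu : 0 ≤ u) : μ.real {t | cdf μ t ≤ u} ≤ u := by
  refine le_of_forall_gt_imp_ge_of_dense fun a ha => ?_
  rcases lt_or_ge a 1 with h1 | h1
  · obtain ⟨t, rfl⟩ := exists_cdf_eq (μ := μ) (hu.trans_lt ha) h1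
    rw [cdf_eq_real μ t]
    refine measureReal_mono fun s hs => ?_
    exact ((monotone_cdf μ).reflect_lt (lt_of_le_of_lt hs ha)).le
  · exact measureReal_le_one.trans h1

lemma le_real_cdf_lt {u : ℝ} (hu : u ≤ 1) : u ≤ μ.real {t | cdf μ t < u} := by
  refine le_of_forall_lt_imp_le_of_dense fun a ha => ?_
  rcases le_or_gt a 0 with h0 | h0
  · exact h0.trans measureReal_nonneg
  · obtain ⟨t, rfl⟩ := exists_cdf_eq (μ := μ) h0 (ha.trans_le hu)
    rw [cdf_eq_real μ t]
    exact measureReal_mono fun s hs => lt_of_le_of_lt (monotone_cdf μ hs) ha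

end CDF

/-- Player 1's strategy: type `t` bids `v F(t)`. -/
noncomputable def cdfBid (μ : Measure ℝ) (v : ℝ) : Measure (ℝ × ℝ) :=
  μ.map fun t => (t, v * cdf μ t)

/-- Bid law of a rival of valuation `v`: an atom at `0`, and the density `(F⁻¹(x / v))⁻¹`
on `(0, v)`. -/
noncomputable def rivalBidLaw (μ : Measure ℝ) (v : ℝ) : Measure ℝ :=
  (1 - ENNReal.ofReal v * invQuantileIntegral μ) • Measure.dirac 0 +
    ENNReal.ofReal v • (((volume.restrict (Ioo 0 1)).withDensity
      fun s => (ENNReal.ofReal (quantile μ s))⁻¹).map (v * ·))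

section Strategies

variable {μ : Measure ℝ} {v : ℝ}

lemma measurable_cdfBid (μ : Measure ℝ) (v : ℝ) : Measurable fun t => (t, v * cdf μ t) :=
  measurable_id.prodMk ((monotone_cdf μ).measurable.const_mul v)

lemma real_cdfBid {s : Set ℝ} (hs : MeasurableSet s) :
    (cdfBid μ v).real {p | p.2 ∈ s} = μ.real {t | v * cdf μ t ∈ s} :=
  map_measureReal_apply (measurable_cdfBid μ v) (measurable_snd hs)

instance [IsProbabilityMeasure μ] : IsProbabilityMeasure (cdfBid μ v) :=
  Measure.isProbabilityMeasure_map (measurable_cdfBid μ v).aemeasurable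

lemma rivalBidLaw_apply {s : Set ℝ} (hs : MeasurableSet s) :
    rivalBidLaw μ v s = (1 - ENNReal.ofReal v * invQuantileIntegral μ) * s.indicator 1 0 +
      ENNReal.ofReal v * ∫⁻ u in (v * ·) ⁻¹' s ∩ Ioo 0 1, (ENNReal.ofReal (quantile μ u))⁻¹ := by
  have hm : Measurable (v * · : ℝ → ℝ) := measurable_const_mul v
  rw [rivalBidLaw, Measure.add_apply, Measure.smul_apply, Measure.smul_apply,
    Measure.dirac_apply' _ hs, Measure.map_apply hm hs, withDensity_apply _ (hm hs),
    Measure.restrict_restrict (hm hs), smul_eq_mul, smul_eq_mul]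

lemma isProbabilityMeasure_rivalBidLaw (hI : ENNReal.ofReal v * invQuantileIntegral μ ≤ 1) :
    IsProbabilityMeasure (rivalBidLaw μ v) := by
  refine ⟨?_⟩
  rw [rivalBidLaw_apply MeasurableSet.univ]
  simpa [invQuantileIntegral] using tsub_add_cancel_of_le hI

lemma ae_rivalBidLaw_mem_Icc (hv : 0 < v) : ∀ᵐ x ∂rivalBidLaw μ v, x ∈ Icc 0 v := by
  refine ae_iff.2 ?_
  have hc : {x | ¬ x ∈ Icc 0 v} = (Icc 0 v)ᶜ := rfl
  rw [hc, rivalBidLaw_apply measurableSet_Icc.compl]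
  have he : (v * ·) ⁻¹' (Icc 0 v)ᶜ ∩ Ioo (0 : ℝ) 1 = ∅ := by
    refine eq_empty_of_forall_notMem fun u hu => hu.1 ⟨mul_nonneg hv.le hu.2.1.le, ?_⟩
    exact mul_le_of_le_one_right hv.le hu.2.2.le
  rw [he]
  simp [hv.le]

variable {lo hi : ℝ}

/-- Below the bid of type `t` the relevant quantiles are at most `t`, so the rival's density is at
least `1 / t`: lowering the bid loses at least as much as it saves. -/
lemma ofReal_le_rivalBidLaw_Ioo (h : IsPrior μ lo hi) (hv : 0 < v) {t β : ℝ} (ht : t ∈ Ioc lo hi)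
    (hβ : 0 ≤ β) :
    ENNReal.ofReal ((v * cdf μ t - β) / t) ≤ rivalBidLaw μ v (Ioo β (v * cdf μ t)) := by
  have ht0 : 0 < t := h.nonneg.trans_lt ht.1
  rw [rivalBidLaw_apply measurableSet_Ioo]
  refine le_add_left ?_
  have hsub : Ioo (β / v) (cdf μ t) ⊆ (v * ·) ⁻¹' Ioo β (v * cdf μ t) ∩ Ioo 0 1 := fun u hu =>
    ⟨⟨(div_lt_iff₀' hv).1 hu.1, mul_lt_mul_of_pos_left hu.2 hv⟩,
      (div_nonneg hβ hv.le).trans_lt hu.1, hu.2.trans_le (cdf_le_one μ t)⟩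
  calc ENNReal.ofReal ((v * cdf μ t - β) / t)
      = ENNReal.ofReal v * ∫⁻ _ in Ioo (β / v) (cdf μ t), (ENNReal.ofReal t)⁻¹ := by
        rw [setLIntegral_const, Real.volume_Ioo, ← ENNReal.ofReal_inv_of_pos ht0,
          ← ENNReal.ofReal_mul (inv_nonneg.2 ht0.le), ← ENNReal.ofReal_mul hv.le]
        congr 1
        field_simp
    _ ≤ ENNReal.ofReal v * ∫⁻ u in Ioo (β / v) (cdf μ t), (ENNReal.ofReal (quantile μ u))⁻¹ := by
        gcongr 1
        refine setLIntegral_mono' measurableSet_Ioo fun u hu => ?_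
        gcongr
        exact h.quantile_le ⟨ht.1.le, ht.2⟩ hu.2.le
    _ ≤ _ := by
        gcongr 1
        exact lintegral_mono_set hsub

variable [IsProbabilityMeasure μ]

lemma mul_winProb_cdfBid_le [NullSingletonClass μ] (hv : 0 < v) {β : ℝ} (hβ : 0 ≤ β) :
    v * winProb (cdfBid μ v) β ≤ β := by
  rw [mul_comm, ← le_div_iff₀ hv]
  refine (winProb_le_real_le _ β).trans ?_
  refine (real_cdfBid measurableSet_Iic).trans_le ?_
  refine le_trans (measureReal_mono fun t ht => ?_) (real_cdf_le_le (μ := μ) (div_nonneg hβ hv.le))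
  exact (le_div_iff₀' hv).2 ht

lemma mul_winProb_cdfBid [NullSingletonClass μ] (hv : 0 < v) {β : ℝ} (hβ : β ∈ Icc 0 v) :
    v * winProb (cdfBid μ v) β = β := by
  refine le_antisymm (mul_winProb_cdfBid_le hv hβ.1) ?_
  rw [mul_comm, ← div_le_iff₀ hv]
  refine le_trans ?_ (real_lt_le_winProb _ β)
  refine le_trans ?_ (real_cdfBid measurableSet_Iio).symm.le
  refine (le_real_cdf_lt (μ := μ) ((div_le_one hv).2 hβ.2)).trans (measureReal_mono fun t ht => ?_)
  exact (lt_div_iff₀' hv).1 ht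

/-- Above the bid of type `t` the density is at most `1 / t`, so raising the bid does not pay. Since
`t > lo`, that bid is positive and the atom at `0` plays no role. -/
lemma rivalBidLaw_Icc_le_ofReal (h : IsPrior μ lo hi) (hv : 0 < v) {t β : ℝ} (ht : t ∈ Ioc lo hi) :
    rivalBidLaw μ v (Icc (v * cdf μ t) β) ≤ ENNReal.ofReal ((β - v * cdf μ t) / t) := by
  have ht0 : 0 < t := h.nonneg.trans_lt ht.1
  have hF : 0 < cdf μ t := by
    rw [cdf_eq_real]
    refine ENNReal.toReal_pos ?_ (measure_ne_top _ _)
    exact ((Measure.mem_support_iff_forall lo).1 (h.support_eq ▸ left_mem_Icc.2 h.lt.le) _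
      (Iic_mem_nhds ht.1)).ne'
  have h0 : (0 : ℝ) ∉ Icc (v * cdf μ t) β := fun hm => absurd hm.1 (not_le.2 (mul_pos hv hF))
  rw [rivalBidLaw_apply measurableSet_Icc, indicator_of_notMem h0, mul_zero, zero_add]
  have hsub : (v * ·) ⁻¹' Icc (v * cdf μ t) β ∩ Ioo 0 1 ⊆ Icc (cdf μ t) (β / v) ∩ Ioo 0 1 :=
    fun u hu => ⟨⟨le_of_mul_le_mul_left hu.1.1 hv, (le_div_iff₀' hv).2 hu.1.2⟩, hu.2⟩
  calc ENNReal.ofReal v * ∫⁻ u in (v * ·) ⁻¹' Icc (v * cdf μ t) β ∩ Ioo 0 1,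
          (ENNReal.ofReal (quantile μ u))⁻¹
      ≤ ENNReal.ofReal v * ∫⁻ u in Icc (cdf μ t) (β / v) ∩ Ioo 0 1,
          (ENNReal.ofReal (quantile μ u))⁻¹ := by
        gcongr 1
        exact lintegral_mono_set hsub
    _ ≤ ENNReal.ofReal v * ∫⁻ _ in Icc (cdf μ t) (β / v) ∩ Ioo 0 1, (ENNReal.ofReal t)⁻¹ := by
        gcongr 1
        -- The endpoint `u = F(t)` is discarded: if `F` were flat to the left of `t`, the quantile
        -- there would fall below `t`.
        refine lintegral_mono_ae ?_
        filter_upwards [ae_restrict_mem (measurableSet_Icc.inter measurableSet_Ioo),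
          ae_restrict_of_ae (compl_mem_ae_iff.2 (measure_singleton (μ := volume) (cdf μ t)))]
          with u hu hne
        gcongr
        exact h.le_quantile hu.2.2.le (lt_of_le_of_ne hu.1.1 (Ne.symm hne))
    _ ≤ ENNReal.ofReal v * ∫⁻ _ in Icc (cdf μ t) (β / v), (ENNReal.ofReal t)⁻¹ := by
        gcongr 1
        exact lintegral_mono_set inter_subset_left
    _ = ENNReal.ofReal ((β - v * cdf μ t) / t) := by
        rw [setLIntegral_const, Real.volume_Icc, ← ENNReal.ofReal_inv_of_pos ht0,
          ← ENNReal.ofReal_mul (inv_nonneg.2 ht0.le), ← ENNReal.ofReal_mul hv.le]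
        congr 1
        field_simp

end Strategies

section Equilibrium

variable {μ : Measure ℝ} [IsProbabilityMeasure μ] {lo hi v : ℝ}

lemma isBestResponse_cdfBid (h : IsPrior μ lo hi) (hv : 0 < v)
    (hI : ENNReal.ofReal v * invQuantileIntegral μ ≤ 1) :
    IsBestResponse μ (cdfBid μ v) ((Measure.dirac v).prod (rivalBidLaw μ v)) := by
  have hG := isProbabilityMeasure_rivalBidLaw hI
  set G := rivalBidLaw μ v with hGdef
  set τ := (Measure.dirac v).prod G with hτ
  have hreal : ∀ s : Set ℝ, MeasurableSet s → τ.real {p | p.2 ∈ s} = G.real s := by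
    intro s hs
    have : τ.map Prod.snd = G := by simp [hτ]
    rw [← this, map_measureReal_apply measurable_snd hs]
    rfl
  -- Sandwiching the winning probability between open and closed half-lines avoids any discussion of
  -- ties, including those at the atom.
  have hlow : ∀ β, G.real (Iio β) ≤ winProb τ β := fun β =>
    (hreal _ measurableSet_Iio).symm.trans_le (real_lt_le_winProb τ β)
  have hupp : ∀ β, winProb τ β ≤ G.real (Iic β) := fun β =>
    (winProb_le_real_le τ β).trans_eq (hreal _ measurableSet_Iic)
  refine ⟨inferInstance, ?_, ?_, ?_⟩
  · rw [cdfBid, Measure.map_map measurable_fst (measurable_cdfBid μ v)]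
    exact Measure.map_id
  · refine (ae_map_iff (measurable_cdfBid μ v).aemeasurable
      (measurable_snd measurableSet_Ici)).2 (Filter.Eventually.of_forall fun t => ?_)
    exact mul_nonneg hv.le (cdf_nonneg μ t)
  · have hset : ∀ᵐ p ∂cdfBid μ v, p.1 ∈ Ioc lo hi ∧ p.2 = v * cdf μ p.1 := by
      refine (ae_map_iff (measurable_cdfBid μ v).aemeasurable ?_).2 ?_
      · exact (measurable_fst measurableSet_Ioc).inter (measurableSet_eq_fun measurable_snd
          (((monotone_cdf μ).measurable.comp measurable_fst).const_mul v))
      · filter_upwards [h.ae_mem_Ioc] with t ht using ⟨ht, rfl⟩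
    filter_upwards [hset] with ⟨t, x⟩ ⟨ht, hx⟩ β hβ
    dsimp only at ht hx ⊢
    have ht0 : 0 < t := h.nonneg.trans_lt ht.1
    unfold bidPayoff
    rcases lt_trichotomy β x with hlt | rfl | hlt
    · have hd : (x - β) / t ≤ G.real (Ioo β x) := by
        refine (ENNReal.ofReal_le_iff_le_toReal (measure_ne_top _ _)).1 ?_
        rw [hx]
        exact ofReal_le_rivalBidLaw_Ioo h hv ht hβ
      have hadd : G.real (Iio x) = G.real (Iic β) + G.real (Ioo β x) := by
        rw [← measureReal_union (show Disjoint (Iic β) (Ioo β x) from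
          disjoint_left.2 fun y hy hy' => hy'.1.not_ge hy) measurableSet_Ioo,
          Iic_union_Ioo_eq_Iio hlt]
      have h1 := hlow x
      have h2 := hupp β
      have h3 : (x - β) / t ≤ winProb τ x - winProb τ β := by linarith
      rw [div_le_iff₀ ht0] at h3
      linarith
    · exact le_rfl
    · have hd : G.real (Icc x β) ≤ (β - x) / t := by
        refine ENNReal.toReal_le_of_le_ofReal (div_nonneg (sub_nonneg.2 hlt.le) ht0.le) ?_
        rw [hx]
        exact rivalBidLaw_Icc_le_ofReal h hv ht
      have hadd : G.real (Iic β) = G.real (Iio x) + G.real (Icc x β) := by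
        rw [← measureReal_union (show Disjoint (Iio x) (Icc x β) from
          disjoint_left.2 fun y hy hy' => hy'.1.not_gt hy) measurableSet_Icc,
          Iio_union_Icc_eq_Iic hlt.le]
      have h1 := hlow x
      have h2 := hupp β
      have h3 : winProb τ β - winProb τ x ≤ (β - x) / t := by linarith
      rw [le_div_iff₀ ht0] at h3
      linarith

lemma isBestResponse_rivalBidLaw [NullSingletonClass μ] (hv : 0 < v)
    (hI : ENNReal.ofReal v * invQuantileIntegral μ ≤ 1) :
    IsBestResponse (Measure.dirac v) ((Measure.dirac v).prod (rivalBidLaw μ v)) (cdfBid μ v) := by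
  have hG := isProbabilityMeasure_rivalBidLaw hI
  have hfst : ((Measure.dirac v).prod (rivalBidLaw μ v)).map Prod.fst = Measure.dirac v := by simp
  have hsnd : ((Measure.dirac v).prod (rivalBidLaw μ v)).map Prod.snd = rivalBidLaw μ v := by simp
  have h1 : ∀ᵐ p ∂(Measure.dirac v).prod (rivalBidLaw μ v), p.1 = v := by
    refine ae_of_ae_map (p := fun x => x = v) measurable_fst.aemeasurable ?_
    rw [hfst, ae_dirac_eq]
    exact Filter.eventually_pure.2 rfl
  have h2 : ∀ᵐ p ∂(Measure.dirac v).prod (rivalBidLaw μ v), p.2 ∈ Icc 0 v := by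
    refine ae_of_ae_map measurable_snd.aemeasurable ?_
    rw [hsnd]
    exact ae_rivalBidLaw_mem_Icc hv
  refine ⟨inferInstance, hfst, h2.mono fun p hp => hp.1, ?_⟩
  filter_upwards [h1, h2] with p hp1 hp2 β hβ
  rw [bidPayoff, bidPayoff, hp1, mul_winProb_cdfBid hv hp2, sub_self]
  exact sub_nonpos.2 (mul_winProb_cdfBid_le hv hβ)

/-- The bids leave valuation `v` no rent, and lower valuations gain even less from winning; hence
accepting any `b ≥ 0` is optimal. -/
lemma auctionValue_cdfBid_le_zero [NullSingletonClass μ] (hv : 0 < v) {w : ℝ} (hw : w ≤ v) :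
    auctionValue (cdfBid μ v) w ≤ 0 := by
  refine ciSup_le fun β => sub_nonpos.2 ?_
  exact (mul_le_mul_of_nonneg_right hw (winProb_nonneg _ _)).trans
    (mul_winProb_cdfBid_le hv β.coe_nonneg)

/-- Every type of player 1 offers `0`, every bribe is accepted, and a rejection is attributed to
the highest type `v` of player 2. -/
noncomputable def peacefulAssessment (μ : Measure ℝ) (v : ℝ) : Assessment where
  bribe _ := 0
  reject _ := ∅
  belief₁ _ := μ
  belief₂ _ := Measure.dirac v
  bid₁ _ := cdfBid μ v
  bid₂ _ := (Measure.dirac v).prod (rivalBidLaw μ v)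

lemma isEquilibrium_peacefulAssessment {μ₂ : Measure ℝ} {lo₂ : ℝ} (h : IsPrior μ lo hi)
    (h₂ : IsPrior μ₂ lo₂ v) (hI : ENNReal.ofReal v * invQuantileIntegral μ ≤ 1) :
    (peacefulAssessment μ v).IsEquilibrium μ μ₂ lo hi lo₂ v := by
  have := h.nullSingletonClass
  have hv : 0 < v := h₂.nonneg.trans_lt h₂.lt
  have hIcc : μ (Icc lo hi) = 1 := (mem_ae_iff_prob_eq_one measurableSet_Icc).1 h.ae_mem_Icc
  refine ⟨measurable_const, fun _ _ => le_rfl, fun _ _ => MeasurableSet.empty,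
    fun _ _ => ⟨inferInstanceAs (IsProbabilityMeasure μ), hIcc⟩, ?_, ?_, ?_, ?_,
    fun _ _ => ⟨isBestResponse_cdfBid (μ := μ) h hv hI, isBestResponse_rivalBidLaw hv hI⟩, ?_, ?_, ?_⟩
  · change ∀ᵐ b ∂μ.map (fun _ => 0), μ = condDistrib id (fun _ => (0 : ℝ)) μ b
    rw [Measure.map_const, measure_univ, one_smul, ae_dirac_eq]
    exact Filter.eventually_pure.2
      (condDistrib_id_of_ae_eq_const (Filter.EventuallyEq.refl _ _)).symm
  · intro v₁ _
    have hset : {w | w ∈ Icc lo hi ∧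
        (peacefulAssessment μ v).bribe w = (peacefulAssessment μ v).bribe v₁} = Icc lo hi :=
      Set.ext fun w => and_iff_left rfl
    rw [hset]
    exact hIcc
  · intro b _
    refine ⟨Measure.dirac.isProbabilityMeasure, ?_⟩
    simp [peacefulAssessment, h₂.lt.le]
  · intro b _ hne
    simp [peacefulAssessment] at hne
  · intro b _ w _ hw
    exact absurd hw (notMem_empty w)
  · intro b hb w hw _
    exact (auctionValue_cdfBid_le_zero hv hw.2).trans hb
  -- Every bribe is accepted, so a positive one only costs player 1 more.
  · intro v₁ _ b hb
    simpa [Assessment.payoff₁, peacefulAssessment] using hb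

end Equilibrium

end Bribing

theorem mainTheorem7 (μ₁ μ₂ : MeasureTheory.Measure ℝ)
    [MeasureTheory.IsProbabilityMeasure μ₁] [MeasureTheory.IsProbabilityMeasure μ₂]
    (lo₁ hi₁ lo₂ hi₂ : ℝ)
    (h₁ : Bribing.IsPrior μ₁ lo₁ hi₁) (h₂ : Bribing.IsPrior μ₂ lo₂ hi₂) :
    (ENNReal.ofReal hi₂ * Bribing.invQuantileIntegral μ₁ ≤ 1 →
      Bribing.PeaceImplementable μ₁ μ₂ lo₁ hi₁ lo₂ hi₂ ∧
      ∃ A : Bribing.Assessment, A.IsEquilibrium μ₁ μ₂ lo₁ hi₁ lo₂ hi₂ ∧ A.IsPeaceful μ₁ μ₂ ∧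
        (∀ v₁ ∈ Set.Icc lo₁ hi₁, A.bribe v₁ = 0) ∧
        (∀ v₂ ∈ Set.Icc lo₂ hi₂, v₂ ∉ A.reject 0)) ∧
    (1 < ENNReal.ofReal hi₂ * Bribing.invQuantileIntegral μ₁ → lo₁ = 0 →
      ¬ Bribing.PeaceImplementable μ₁ μ₂ lo₁ hi₁ lo₂ hi₂) := by
  refine ⟨fun hI => ?_, ?_⟩
  · have hE := Bribing.isEquilibrium_peacefulAssessment h₁ h₂ hI
    have hP : (Bribing.peacefulAssessment μ₁ hi₂).IsPeaceful μ₁ μ₂ :=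
      Filter.Eventually.of_forall fun _ => measure_empty
    exact ⟨⟨_, hE, hP⟩, _, hE, hP, fun _ _ => rfl, fun v₂ _ => notMem_empty v₂⟩
  · rintro hI rfl hP
    exact hI.not_ge (hP.mul_invQuantileIntegral_le_one h₁ h₂)
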